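/- For $n\ge 0$ let $\mathrm{Matching}_n$ be the following two-party communication problem: Alice receives a set $E_A\subseteq[n]\times[n]$, Bob receives a set $E_B\subseteq[n]\times[n]$, and they have to decide whether the $n\times n$ bipartite graph with edge set $E_A\cup E_B$ has a perfect matching. For a (possibly partial) Boolean two-party problem $f$ let $Q_2(f)$ be the minimum number of qubits exchanged by a quantum protocol that computes $f$ with error probability at most $1/3$ on every allowed pair of inputs, and let $Q_2^*(f)$ be the same quantity when the parties may in addition start with an arbitrary, input-independent shared (entangled) state of any finite number of qubits. Then $$Q_2(\mathrm{Matching}_n)=\Omega(n)\qquad\text{and}\qquad Q_2^*(\mathrm{Matching}_n)=\Omega(n),$$ and the bound $Q_2^*=\Omega(n)$ still holds for the restriction of $\mathrm{Matching}_n$ to inputs with $E_A\cap E_B=\emptyset$. Moreover, the inner product problem reduces to this restriction with linear blow-up: there is a constant $k$ such that for every $m\ge 1$ there are $n\le km$ and maps $\alpha,\beta$ from $\{0,1\}^m$ to the subsets of $[n]\times[n]$ such that for all $x,y\in\{0,1\}^m$ the sets $\alpha(x)$ and $\beta(y)$ are disjoint, and the bipartite graph with edge set $\alpha(x)\cup\beta(y)$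 has a perfect matching if and only if $\mathrm{IP}_m(x,y)=\sum_{i=1}^m x_iy_i \bmod 2$ equals $1$. -/

import Mathlib

namespace QComm

/-- Computational basis states of a register of `k` qubits. -/
abbrev Basis (k : ℕ) : Type := Fin k → Bool

/-- A joint pure state of Alice (`a` qubits) and Bob (`b` qubits): the amplitude of the basis
state `|i⟩|j⟩` is the entry `ψ i j`. A local operation `U` of Alice is `ψ ↦ U * ψ`, a local
operation `V` of Bob is `ψ ↦ ψ * Vᵀ`. -/
abbrev JointState (a b : ℕ) : Type := Matrix (Basis a) (Basis b) ℂ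

/-- The state is a unit vector. -/
def JointState.IsUnit {a b : ℕ} (ψ : JointState a b) : Prop :=
  ∑ i, ∑ j, ‖ψ i j‖ ^ 2 = 1

/-- The state of the two parties when neither holds any qubit. -/
def JointState.empty : JointState 0 0 := fun _ _ => 1

/-- Isometries from `k` to `l` qubits. These are the maps "adjoin fresh qubits in state
`|0⟩`, then apply a unitary". -/
def Isometries (k l : ℕ) : Set (Matrix (Basis l) (Basis k) ℂ) :=
  {U | U.conjTranspose * U = 1}

/-- The qubit number `0` of Alice is handed over to Bob, as his new qubit number `0`. -/
def JointState.passToBob {a b : ℕ} (ψ : JointState (a + 1) b) : JointState a (b + 1) :=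
  fun i j => ψ (Fin.cons (j 0) i) (Fin.tail j)

/-- The qubit number `0` of Bob is handed over to Alice, as her new qubit number `0`. -/
def JointState.passToAlice {a b : ℕ} (ψ : JointState a (b + 1)) : JointState (a + 1) b :=
  fun i j => ψ (Fin.tail i) (Fin.cons (i 0) j)

/-- Two-party quantum protocols in which Alice, with input in `X`, currently holds `a` qubits and
Bob, with input in `Y`, currently holds `b` qubits. In each step one party applies a local
operation that depends on that party's own input (with fresh ancilla qubits at will) and sends
one qubit to the other party. At the end one party applies a local operation and measures one of
the qubits in that party's possession; the outcome is the output. Local randomness and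
intermediate measurements are covered, as ancilla qubits are free. -/
inductive Protocol (X Y : Type*) : ℕ → ℕ → Type _
  | aliceSend {a b a' : ℕ} (U : X → Isometries a (a' + 1)) (rest : Protocol X Y a' (b + 1)) :
      Protocol X Y a b
  | bobSend {a b b' : ℕ} (V : Y → Isometries b (b' + 1)) (rest : Protocol X Y (a + 1) b') :
      Protocol X Y a b
  | aliceOutput {a b a' : ℕ} (U : X → Isometries a (a' + 1)) : Protocol X Y a b
  | bobOutput {a b b' : ℕ} (V : Y → Isometries b (b' + 1)) : Protocol X Y a b

variable {X Y : Type*}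

/-- The communication cost: the number of qubits sent. -/
def Protocol.cost : {a b : ℕ} → Protocol X Y a b → ℕ
  | _, _, .aliceSend _ rest => rest.cost + 1
  | _, _, .bobSend _ rest => rest.cost + 1
  | _, _, .aliceOutput _ => 0
  | _, _, .bobOutput _ => 0

/-- The probability of output `1` on inputs `x`, `y`, started in the joint state `ψ`. -/
noncomputable def Protocol.acceptProb (x : X) (y : Y) :
    {a b : ℕ} → Protocol X Y a b → JointState a b → ℝ
  | _, _, .aliceSend U rest, ψ =>
      rest.acceptProb x y (JointState.passToBob ((U x).1 * ψ))
  | _, _, .bobSend V rest, ψ =>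
      rest.acceptProb x y (JointState.passToAlice (ψ * (V y).1.transpose))
  | _, _, .aliceOutput (a' := a') U, ψ =>
      ∑ i : Basis a', ∑ j, ‖((U x).1 * ψ) (Fin.cons true i) j‖ ^ 2
  | _, _, .bobOutput (b' := b') V, ψ =>
      ∑ i, ∑ j : Basis b', ‖(ψ * (V y).1.transpose) i (Fin.cons true j)‖ ^ 2

/-- Started in `ψ`, the protocol computes `f` with error probability at most `1/3` on every pair
of inputs that satisfies the promise `D`. -/
def Protocol.Computes {a b : ℕ} (P : Protocol X Y a b) (ψ : JointState a b)
    (D f : X → Y → Prop) : Prop :=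
  ∀ x y, D x y →
    (f x y → 2 / 3 ≤ P.acceptProb x y ψ) ∧ (¬ f x y → P.acceptProb x y ψ ≤ 1 / 3)

/-- Bounded-error quantum communication complexity (no prior entanglement) of `f` under the
promise `D`: the parties start without any qubits. -/
noncomputable def Q₂ (D f : X → Y → Prop) : ℕ∞ :=
  ⨅ (P : Protocol X Y 0 0) (_ : P.Computes JointState.empty D f), (P.cost : ℕ∞)

/-- Bounded-error quantum communication complexity of `f` under the promise `D` with unlimited
prior entanglement: the parties may start in any joint state, independent of the inputs, of any
number of qubits. -/
noncomputable def Q₂Ent (D f : X → Y → Prop) : ℕ∞ :=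
  ⨅ (a : ℕ) (b : ℕ) (ψ : JointState a b) (_ : ψ.IsUnit) (P : Protocol X Y a b)
    (_ : P.Computes ψ D f), (P.cost : ℕ∞)

/-- No promise: all pairs of inputs are allowed. -/
def allInputs : X → Y → Prop := fun _ _ => True

/-- The `n × n` bipartite graph with edge set `E`: `(i, j) ∈ E` joins the left vertex `i` to the
right vertex `j`. -/
def bipartiteGraph {n : ℕ} (E : Set (Fin n × Fin n)) : SimpleGraph (Fin n ⊕ Fin n) :=
  SimpleGraph.fromRel fun u v => ∃ e ∈ E, u = Sum.inl e.1 ∧ v = Sum.inr e.2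

/-- `Matching_n`: Alice and Bob hold edge sets `EA` and `EB`; does the `n × n` bipartite graph with
edge set `EA ∪ EB` have a perfect matching? -/
def Matching (n : ℕ) (EA EB : Set (Fin n × Fin n)) : Prop :=
  ∃ M : (bipartiteGraph (EA ∪ EB)).Subgraph, M.IsPerfectMatching

/-- The promise that no edge is given to both parties. -/
def disjointEdges (n : ℕ) (EA EB : Set (Fin n × Fin n)) : Prop := Disjoint EA EB

/-- Inner product modulo `2` of two `m`-bit strings. -/
def IP (m : ℕ) (x y : Fin m → Bool) : Prop :=
  Odd (Finset.univ.filter fun i => x i = true ∧ y i = true).card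

end QComm

/-! The inner product function is hard even with entanglement, and it embeds into matching with
linear blow-up. Hardness: unfolding a protocol with `q` qubits of communication writes its
acceptance probability as `4 ^ q` terms `tr(ψᴴ E(x) ψ F(y))` with local contractions `E`, `F`
(`Protocol.acceptProb_eq_sum_trace`). Each term is an inner product of vectors of norm at most `1`,
whatever the dimension of `ψ`, so its correlation with a matrix `h` is at most `‖h‖ √(|X| |Y|)`. The
Hadamard matrix has norm at most `2 ^ (m / 2)`, while a correct protocol correlates with it to order
`4 ^ m`; hence `q` is linear in `m` (`Protocol.le_cost_of_computes_IP`). Reduction: the parity of `x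
i ∧ y i` is computed along a path through a layered graph. With loops at all vertices except the
start and the accepting end, and an edge from that end back to the start, a perfect matching between
two copies of the vertex set is a permutation along edges. It must move the start, hence follows the
whole path, and can close up only if the parity is odd (`exists_perm_iff_IP`). -/

namespace QComm

open scoped Matrix Matrix.Norms.L2Operator

/-! ### Operator norms and correlation bounds -/

section Norms

variable {k l n : Type*} [Fintype k] [Fintype l] [Fintype n]

theorem norm_le_one_of_conjTranspose_mul_self_eq_one [DecidableEq k] {A : Matrix l k ℂ}
    (h : Aᴴ * A = 1) :
    ‖A‖ ≤ 1 := by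
  have h1 : ‖A‖ * ‖A‖ ≤ 1 := by
    rw [← Matrix.l2_opNorm_conjTranspose_mul_self, h]
    rcases isEmpty_or_nonempty k with hk | hk
    · rw [Subsingleton.elim (1 : Matrix k k ℂ) 0, norm_zero]; exact zero_le_one
    · exact CStarRing.norm_one.le
  nlinarith [norm_nonneg A]

theorem norm_le_one_of_mul_conjTranspose_self_eq_one [DecidableEq k] [DecidableEq l]
    {A : Matrix l k ℂ} (h : A * Aᴴ = 1) :
    ‖A‖ ≤ 1 := by
  rw [← Matrix.l2_opNorm_conjTranspose]
  exact norm_le_one_of_conjTranspose_mul_self_eq_one (by rwa [Matrix.conjTranspose_conjTranspose])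

theorem norm_mul_le_one [DecidableEq k] [DecidableEq n] {A : Matrix l k ℂ} {B : Matrix k n ℂ}
    (hA : ‖A‖ ≤ 1) (hB : ‖B‖ ≤ 1) :
    ‖A * B‖ ≤ 1 :=
  (Matrix.l2_opNorm_mul A B).trans (mul_le_one₀ hA (norm_nonneg _) hB)

/-- The squared Frobenius norm. -/
noncomputable def frobSq (A : Matrix l k ℂ) : ℝ := ∑ i, ∑ j, ‖A i j‖ ^ 2

theorem trace_conjTranspose_mul (A B : Matrix l k ℂ) :
    (Aᴴ * B).trace = ∑ p : l × k, star (A p.1 p.2) * B p.1 p.2 := by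
  rw [Fintype.sum_prod_type_right]
  simp [Matrix.trace, Matrix.mul_apply]

theorem frobSq_eq_trace (A : Matrix l k ℂ) : (frobSq A : ℂ) = (Aᴴ * A).trace := by
  rw [trace_conjTranspose_mul, Fintype.sum_prod_type, frobSq]
  push_cast
  refine Finset.sum_congr rfl fun i _ => Finset.sum_congr rfl fun j _ => ?_
  exact (Complex.conj_mul' _).symm

theorem frobSq_conjTranspose (A : Matrix l k ℂ) : frobSq Aᴴ = frobSq A := by
  unfold frobSq
  rw [Finset.sum_comm]
  simp

theorem frobSq_mul_le [DecidableEq k] (A : Matrix l k ℂ) (B : Matrix k n ℂ) (hA : ‖A‖ ≤ 1) :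
    frobSq (A * B) ≤ frobSq B := by
  unfold frobSq
  rw [Finset.sum_comm, Finset.sum_comm (s := (Finset.univ : Finset k))]
  refine Finset.sum_le_sum fun j _ => ?_
  have h := Matrix.l2_opNorm_mulVec A (WithLp.toLp 2 fun i => B i j)
  have h2 : ‖(WithLp.toLp 2 (A *ᵥ fun i => B i j) : EuclideanSpace ℂ l)‖
      ≤ ‖(WithLp.toLp 2 fun i => B i j : EuclideanSpace ℂ k)‖ :=
    h.trans (mul_le_of_le_one_left (norm_nonneg _) hA)
  have h3 := pow_le_pow_left₀ (norm_nonneg _) h2 2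
  rw [EuclideanSpace.norm_sq_eq, EuclideanSpace.norm_sq_eq] at h3
  exact h3

theorem frobSq_mul_le' [DecidableEq k] [DecidableEq n] (A : Matrix l k ℂ) (B : Matrix k n ℂ) (hB : ‖B‖ ≤ 1) :
    frobSq (A * B) ≤ frobSq A := by
  rw [← frobSq_conjTranspose, ← frobSq_conjTranspose A, Matrix.conjTranspose_mul]
  exact frobSq_mul_le _ _ (by rwa [Matrix.l2_opNorm_conjTranspose])

theorem norm_sum_star_mul_mul_le [DecidableEq k] (h : Matrix l k ℂ) (a : l → ℂ) (b : k → ℂ) :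
    ‖∑ x, ∑ y, h x y * (star (a x) * b y)‖ ≤
      ‖h‖ * (√(∑ x, ‖a x‖ ^ 2) * √(∑ y, ‖b y‖ ^ 2)) := by
  have e : ∑ x, ∑ y, h x y * (star (a x) * b y) =
      inner ℂ (WithLp.toLp 2 a : EuclideanSpace ℂ l) (WithLp.toLp 2 (h *ᵥ b)) := by
    simp only [PiLp.inner_apply, Matrix.mulVec, dotProduct]
    refine Finset.sum_congr rfl fun x _ => ?_
    simp only [RCLike.inner_apply, Finset.sum_mul, starRingEnd_apply]
    exact Finset.sum_congr rfl fun y _ => by ring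
  rw [e, ← EuclideanSpace.norm_eq (WithLp.toLp 2 a : EuclideanSpace ℂ l),
    ← EuclideanSpace.norm_eq (WithLp.toLp 2 b : EuclideanSpace ℂ k)]
  calc _ ≤ _ := norm_inner_le_norm _ _
    _ ≤ ‖(WithLp.toLp 2 a : EuclideanSpace ℂ l)‖ *
        (‖h‖ * ‖(WithLp.toLp 2 b : EuclideanSpace ℂ k)‖) :=
      mul_le_mul_of_nonneg_left (Matrix.l2_opNorm_mulVec h (WithLp.toLp 2 b)) (norm_nonneg _)
    _ = _ := by ring

/-- A kernel `(x, y) ↦ ⟨u x, v y⟩` with vectors of norm at most `C` has correlation at most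
`C² √(|X| |Y|) ‖h‖` with `h`. -/
theorem norm_sum_mul_inner_le {X Y K : Type*} [Fintype X] [Fintype Y]
    [DecidableEq Y] [Fintype K] (h : Matrix X Y ℂ) (u : X → K → ℂ) (v : Y → K → ℂ) {C : ℝ}
    (hu : ∀ x, ∑ p, ‖u x p‖ ^ 2 ≤ C) (hv : ∀ y, ∑ p, ‖v y p‖ ^ 2 ≤ C) :
    ‖∑ x, ∑ y, h x y * ∑ p, star (u x p) * v y p‖ ≤
      ‖h‖ * (√(Fintype.card X * C) * √(Fintype.card Y * C)) := by
  -- For each fixed `p` the kernel has rank one; the coordinates are then recombined by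
  -- Cauchy–Schwarz.
  have e : ∑ x, ∑ y, h x y * ∑ p, star (u x p) * v y p =
      ∑ p, ∑ x, ∑ y, h x y * (star (u x p) * v y p) := by
    simp only [Finset.mul_sum]
    rw [Finset.sum_comm]
    refine (Finset.sum_congr rfl fun y _ => Finset.sum_comm).trans ?_
    rw [Finset.sum_comm]
    exact Finset.sum_congr rfl fun p _ => Finset.sum_comm
  rw [e]
  calc _ ≤ ∑ p, ‖∑ x, ∑ y, h x y * (star (u x p) * v y p)‖ := norm_sum_le _ _
    _ ≤ ∑ p, ‖h‖ * (√(∑ x, ‖u x p‖ ^ 2) * √(∑ y, ‖v y p‖ ^ 2)) :=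
      Finset.sum_le_sum fun p _ =>
        norm_sum_star_mul_mul_le h (fun x => u x p) (fun y => v y p)
    _ = ‖h‖ * ∑ p, √(∑ x, ‖u x p‖ ^ 2) * √(∑ y, ‖v y p‖ ^ 2) := by rw [Finset.mul_sum]
    _ ≤ ‖h‖ * (√(∑ p, ∑ x, ‖u x p‖ ^ 2) * √(∑ p, ∑ y, ‖v y p‖ ^ 2)) := by
      refine mul_le_mul_of_nonneg_left ?_ (norm_nonneg _)
      exact Real.sum_sqrt_mul_sqrt_le _ (fun p => by positivity) (fun p => by positivity)
    _ ≤ _ := by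
      refine mul_le_mul_of_nonneg_left ?_ (norm_nonneg _)
      refine mul_le_mul (Real.sqrt_le_sqrt ?_) (Real.sqrt_le_sqrt ?_) (Real.sqrt_nonneg _)
        (Real.sqrt_nonneg _)
      · rw [Finset.sum_comm]
        exact (Finset.sum_le_sum fun x _ => hu x).trans (by simp)
      · rw [Finset.sum_comm]
        exact (Finset.sum_le_sum fun x _ => hv x).trans (by simp)

/-- The trace is the Hilbert–Schmidt inner product of `(E x)ᴴ * ψ` and `ψ * F y`, both of norm at
most `1`. No dimension of `ψ` enters the bound, which is why prior entanglement does not help. -/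
theorem norm_sum_mul_trace_le [DecidableEq k] [DecidableEq l] {X Y : Type*} [Fintype X]
    [Fintype Y] [DecidableEq Y] (h : Matrix X Y ℂ) (E : X → Matrix l l ℂ) (F : Y → Matrix k k ℂ)
    (hE : ∀ x, ‖E x‖ ≤ 1) (hF : ∀ y, ‖F y‖ ≤ 1) (ψ : Matrix l k ℂ) (hψ : frobSq ψ ≤ 1) :
    ‖∑ x, ∑ y, h x y * (ψᴴ * E x * ψ * F y).trace‖ ≤
      ‖h‖ * (√(Fintype.card X) * √(Fintype.card Y)) := by
  have key := norm_sum_mul_inner_le h (fun x (p : l × k) => ((E x)ᴴ * ψ) p.1 p.2)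
    (fun y p => (ψ * F y) p.1 p.2) (C := 1)
    (fun x => by
      rw [Fintype.sum_prod_type]
      exact (frobSq_mul_le _ _ (by rw [Matrix.l2_opNorm_conjTranspose]; exact hE x)).trans hψ)
    (fun y => by
      rw [Fintype.sum_prod_type]
      exact (frobSq_mul_le' _ _ (hF y)).trans hψ)
  simp only [← trace_conjTranspose_mul, mul_one] at key
  refine le_of_eq_of_le ?_ key
  simp only [Matrix.conjTranspose_mul, Matrix.conjTranspose_conjTranspose, Matrix.mul_assoc]

end Norms

/-! ### Unfolding a protocol into local contractions -/

/-- The operation `⟨s| ⊗ 1` that projects qubit number `0` onto the basis state `|s⟩`. -/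
def bra (k : ℕ) (s : Bool) : Matrix (Basis k) (Basis (k + 1)) ℂ :=
  fun i j => if j = (Fin.cons s i : Basis (k + 1)) then 1 else 0

theorem bra_mul_apply {k : ℕ} {n : Type*} (s : Bool) (A : Matrix (Basis (k + 1)) n ℂ)
    (i : Basis k) (j : n) : (bra k s * A) i j = A (Fin.cons s i : Basis (k + 1)) j := by
  simp [bra, Matrix.mul_apply]

theorem mul_conjTranspose_bra_apply {k : ℕ} {n : Type*} (s : Bool)
    (A : Matrix n (Basis (k + 1)) ℂ) (i : n) (j : Basis k) :
    (A * (bra k s)ᴴ) i j = A i (Fin.cons s j : Basis (k + 1)) := by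
  simp [bra, Matrix.mul_apply, Matrix.conjTranspose_apply, apply_ite]

theorem eq_cons_iff {k : ℕ} (s : Bool) (j : Basis (k + 1)) (i : Basis k) :
    j = (Fin.cons s i : Basis (k + 1)) ↔ i = Fin.tail j ∧ s = j 0 := by
  constructor
  · rintro rfl
    simp
  · rintro ⟨rfl, rfl⟩
    exact (Fin.cons_self_tail j).symm

theorem mul_bra_apply {k : ℕ} {n : Type*} (s : Bool) (A : Matrix n (Basis k) ℂ)
    (i : n) (j : Basis (k + 1)) : (A * bra k s) i j = if s = j 0 then A i (Fin.tail j) else 0 := by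
  simp [bra, Matrix.mul_apply, eq_cons_iff, ite_and]

theorem conjTranspose_bra_mul_apply {k : ℕ} {n : Type*} (s : Bool) (A : Matrix (Basis k) n ℂ)
    (i : Basis (k + 1)) (j : n) :
    ((bra k s)ᴴ * A) i j = if s = i 0 then A (Fin.tail i) j else 0 := by
  simp [bra, Matrix.mul_apply, Matrix.conjTranspose_apply, apply_ite, eq_cons_iff, ite_and]
  split_ifs with h <;> simp [h]

theorem bra_mul_conjTranspose (k : ℕ) (s : Bool) : bra k s * (bra k s)ᴴ = 1 := by
  ext i j
  rw [mul_conjTranspose_bra_apply, bra, Matrix.one_apply]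
  simp [Fin.cons_inj, eq_comm]

theorem norm_bra_le (k : ℕ) (s : Bool) : ‖bra k s‖ ≤ 1 :=
  norm_le_one_of_mul_conjTranspose_self_eq_one (bra_mul_conjTranspose k s)

theorem JointState.passToBob_eq_sum {a b : ℕ} (ψ : JointState (a + 1) b) :
    ψ.passToBob = ∑ s, bra a s * ψ * bra b s := by
  ext i j
  simp [Matrix.sum_apply, mul_bra_apply, bra_mul_apply, JointState.passToBob]

theorem JointState.passToAlice_eq_sum {a b : ℕ} (ψ : JointState a (b + 1)) :
    ψ.passToAlice = ∑ s, (bra a s)ᴴ * ψ * (bra b s)ᴴ := by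
  ext i j
  simp [Matrix.sum_apply, Matrix.mul_assoc, conjTranspose_bra_mul_apply,
    mul_conjTranspose_bra_apply, JointState.passToAlice]

theorem norm_isometry_le {k l : ℕ} (U : Isometries k l) : ‖U.1‖ ≤ 1 :=
  norm_le_one_of_conjTranspose_mul_self_eq_one U.2

theorem norm_transpose_isometry_le {k l : ℕ} (U : Isometries k l) : ‖U.1ᵀ‖ ≤ 1 := by
  refine norm_le_one_of_mul_conjTranspose_self_eq_one ?_
  have h : U.1ᴴ * U.1 = 1 := U.2
  have h2 : U.1ᵀᴴ = U.1ᴴᵀ := rfl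
  rw [h2, ← Matrix.transpose_mul, h, Matrix.transpose_one]

/-- The branches `s` and `t` of the transmitted qubit come from the two copies of the state, so each
message multiplies the number of terms by four. Cyclicity of the trace brings the factor `(C s)ᴴ` to
Bob's side. -/
theorem trace_sum_mul_sum {a b a' b' : ℕ} (ψ : Matrix (Basis a) (Basis b) ℂ)
    (R : Bool → Matrix (Basis a') (Basis a) ℂ) (C : Bool → Matrix (Basis b) (Basis b') ℂ)
    (E : Matrix (Basis a') (Basis a') ℂ) (F : Matrix (Basis b') (Basis b') ℂ) :
    ((∑ s, R s * ψ * C s)ᴴ * E * (∑ s, R s * ψ * C s) * F).trace =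
      ∑ s, ∑ t, (ψᴴ * ((R s)ᴴ * E * R t) * ψ * (C t * F * (C s)ᴴ)).trace := by
  simp only [Matrix.conjTranspose_sum, Matrix.sum_mul, Matrix.mul_sum, Matrix.trace_sum]
  rw [Finset.sum_comm]
  refine Finset.sum_congr rfl fun s _ => Finset.sum_congr rfl fun t _ => ?_
  have e : (R s * ψ * C s)ᴴ * E * (R t * ψ * C t) * F =
      (C s)ᴴ * (ψᴴ * ((R s)ᴴ * E * R t) * ψ * (C t * F)) := by
    simp only [Matrix.conjTranspose_mul, Matrix.mul_assoc]
  rw [e, Matrix.trace_mul_comm]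
  simp only [Matrix.mul_assoc]

variable {X Y : Type*}

/-- The acceptance probability of a protocol with `q` qubits of communication is a sum of `4 ^ q`
correlations of local contractions in the initial state. -/
theorem Protocol.acceptProb_eq_sum_trace {a b : ℕ} (P : Protocol X Y a b) :
    ∃ (S : Type) (_ : Fintype S) (E : S → X → Matrix (Basis a) (Basis a) ℂ)
      (F : S → Y → Matrix (Basis b) (Basis b) ℂ),
      Fintype.card S = 4 ^ P.cost ∧ (∀ s x, ‖E s x‖ ≤ 1) ∧ (∀ s y, ‖F s y‖ ≤ 1) ∧
      ∀ x y (ψ : JointState a b),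
        (P.acceptProb x y ψ : ℂ) = ∑ s, (ψᴴ * E s x * ψ * F s y).trace := by
  induction P with
  | @aliceSend a b a' U rest ih =>
    obtain ⟨S, _, E, F, hc, hE, hF, h⟩ := ih
    refine ⟨S × Bool × Bool, inferInstance,
      fun s x => (bra a' s.2.1 * (U x).1)ᴴ * E s.1 x * (bra a' s.2.2 * (U x).1),
      fun s y => bra b s.2.2 * F s.1 y * (bra b s.2.1)ᴴ, ?_, ?_, ?_, ?_⟩
    · simp [Protocol.cost, hc, pow_succ]
    · intro s x
      have hU : ∀ t, ‖bra a' t * (U x).1‖ ≤ 1 := fun t =>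
        norm_mul_le_one (norm_bra_le _ _) (norm_isometry_le _)
      exact norm_mul_le_one (norm_mul_le_one
        (by rw [Matrix.l2_opNorm_conjTranspose]; exact hU _) (hE _ _)) (hU _)
    · intro s y
      exact norm_mul_le_one (norm_mul_le_one (norm_bra_le _ _) (hF _ _))
        (by rw [Matrix.l2_opNorm_conjTranspose]; exact norm_bra_le _ _)
    · intro x y ψ
      simp only [Protocol.acceptProb, h, Fintype.sum_prod_type]
      refine Finset.sum_congr rfl fun s _ => ?_
      rw [JointState.passToBob_eq_sum, ← trace_sum_mul_sum ψ (fun t => bra a' t * (U x).1)]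
      simp only [Matrix.mul_assoc]
  | @bobSend a b b' V rest ih =>
    obtain ⟨S, _, E, F, hc, hE, hF, h⟩ := ih
    refine ⟨S × Bool × Bool, inferInstance,
      -- The double adjoint keeps the shape `(R s)ᴴ * E * R t` of `trace_sum_mul_sum`, with `R t =
      -- (bra a t)ᴴ`.
      fun s x => (bra a s.2.1)ᴴᴴ * E s.1 x * (bra a s.2.2)ᴴ,
      fun s y => ((V y).1ᵀ * (bra b' s.2.2)ᴴ) * F s.1 y * ((V y).1ᵀ * (bra b' s.2.1)ᴴ)ᴴ,
      ?_, ?_, ?_, ?_⟩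
    · simp [Protocol.cost, hc, pow_succ]
    · intro s x
      have hs : ‖(bra a s.2.1)ᴴᴴ‖ ≤ 1 := by
        rw [Matrix.conjTranspose_conjTranspose]; exact norm_bra_le _ _
      exact norm_mul_le_one (norm_mul_le_one hs (hE _ _))
        (by rw [Matrix.l2_opNorm_conjTranspose]; exact norm_bra_le _ _)
    · intro s y
      have hV : ∀ t, ‖(V y).1ᵀ * (bra b' t)ᴴ‖ ≤ 1 := fun t =>
        norm_mul_le_one (norm_transpose_isometry_le _)
          (by rw [Matrix.l2_opNorm_conjTranspose]; exact norm_bra_le _ _)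
      exact norm_mul_le_one (norm_mul_le_one (hV _) (hF _ _))
        (by rw [Matrix.l2_opNorm_conjTranspose]; exact hV _)
    · intro x y ψ
      simp only [Protocol.acceptProb, h, Fintype.sum_prod_type]
      refine Finset.sum_congr rfl fun s _ => ?_
      rw [JointState.passToAlice_eq_sum, ← trace_sum_mul_sum ψ (fun t => (bra a t)ᴴ)]
      simp only [Matrix.mul_assoc]
  | @aliceOutput a b a' U =>
    refine ⟨Unit, inferInstance,
      fun _ x => (bra a' true * (U x).1)ᴴ * (bra a' true * (U x).1), fun _ _ => 1, ?_, ?_, ?_, ?_⟩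
    · simp [Protocol.cost]
    · intro s x
      have hU : ‖bra a' true * (U x).1‖ ≤ 1 :=
        norm_mul_le_one (norm_bra_le _ _) (norm_isometry_le _)
      exact norm_mul_le_one (by rw [Matrix.l2_opNorm_conjTranspose]; exact hU) hU
    · intro s y
      exact norm_le_one_of_mul_conjTranspose_self_eq_one (by simp)
    · intro x y ψ
      have e : (Protocol.aliceOutput (X := X) (Y := Y) (b := b) U).acceptProb x y ψ =
          frobSq (bra a' true * ((U x).1 * ψ)) := by
        simp only [Protocol.acceptProb, frobSq, bra_mul_apply]
      rw [e, frobSq_eq_trace]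
      simp [Matrix.mul_assoc]
  | @bobOutput a b b' V =>
    refine ⟨Unit, inferInstance, fun _ _ => 1,
      fun _ y => ((V y).1ᵀ * (bra b' true)ᴴ) * ((V y).1ᵀ * (bra b' true)ᴴ)ᴴ, ?_, ?_, ?_, ?_⟩
    · simp [Protocol.cost]
    · intro s x
      exact norm_le_one_of_mul_conjTranspose_self_eq_one (by simp)
    · intro s y
      have hV : ‖(V y).1ᵀ * (bra b' true)ᴴ‖ ≤ 1 :=
        norm_mul_le_one (norm_transpose_isometry_le _)
          (by rw [Matrix.l2_opNorm_conjTranspose]; exact norm_bra_le _ _)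
      exact norm_mul_le_one hV (by rw [Matrix.l2_opNorm_conjTranspose]; exact hV)
    · intro x y ψ
      have e : (Protocol.bobOutput (X := X) (Y := Y) (a := a) V).acceptProb x y ψ =
          frobSq (ψ * (V y).1ᵀ * (bra b' true)ᴴ) := by
        simp only [Protocol.acceptProb, frobSq, mul_conjTranspose_bra_apply]
      rw [e, frobSq_eq_trace]
      have e2 : (ψ * (V y).1ᵀ * (bra b' true)ᴴ)ᴴ * (ψ * (V y).1ᵀ * (bra b' true)ᴴ) =
          ((V y).1ᵀ * (bra b' true)ᴴ)ᴴ * (ψᴴ * ψ * ((V y).1ᵀ * (bra b' true)ᴴ)) := by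
        simp only [Matrix.conjTranspose_mul, Matrix.mul_assoc]
      rw [e2, Matrix.trace_mul_comm]
      simp [Matrix.mul_assoc]

theorem Protocol.norm_sum_mul_acceptProb_le [Fintype X] [Fintype Y] [DecidableEq Y]
    {a b : ℕ} (P : Protocol X Y a b) (ψ : JointState a b) (hψ : ψ.IsUnit)
    (h : Matrix X Y ℂ) :
    ‖∑ x, ∑ y, h x y * (P.acceptProb x y ψ : ℂ)‖ ≤
      4 ^ P.cost * (‖h‖ * (√(Fintype.card X) * √(Fintype.card Y))) := by
  obtain ⟨S, _, E, F, hc, hE, hF, hP⟩ := P.acceptProb_eq_sum_trace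
  have e : ∑ x, ∑ y, h x y * (P.acceptProb x y ψ : ℂ) =
      ∑ s, ∑ x, ∑ y, h x y * (ψᴴ * E s x * ψ * F s y).trace := by
    simp only [hP, Finset.mul_sum]
    rw [Finset.sum_comm]
    refine (Finset.sum_congr rfl fun y _ => Finset.sum_comm).trans ?_
    rw [Finset.sum_comm]
    exact Finset.sum_congr rfl fun p _ => Finset.sum_comm
  rw [e]
  calc _ ≤ _ := norm_sum_le _ _
    _ ≤ ∑ s : S, ‖h‖ * (√(Fintype.card X) * √(Fintype.card Y)) :=
      Finset.sum_le_sum fun s _ => norm_sum_mul_trace_le h (E s) (F s) (hE s) (hF s) ψ hψ.le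
    _ = _ := by simp [hc]

/-! ### The lower bound for inner product -/

/-- The `±1` matrix of the inner product function. -/
noncomputable def hadamard (m : ℕ) : Matrix (Fin m → Bool) (Fin m → Bool) ℂ :=
  fun x y => ∏ i, if x i = true ∧ y i = true then -1 else 1

/-- The sum over `x` factors over coordinates; the factor at `i` is `2` if `y i = z i` and `0`
otherwise. -/
theorem hadamard_conjTranspose_mul_self (m : ℕ) :
    (hadamard m)ᴴ * hadamard m = (2 : ℂ) ^ m • (1 : Matrix (Fin m → Bool) (Fin m → Bool) ℂ) := by
  ext y z
  have h1 : ((hadamard m)ᴴ * hadamard m) y z = ∑ x : Fin m → Bool, ∏ i,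
      ((if x i = true ∧ y i = true then -1 else 1) *
        (if x i = true ∧ z i = true then -1 else 1) : ℂ) := by
    simp only [Matrix.mul_apply, Matrix.conjTranspose_apply, hadamard, Finset.prod_mul_distrib]
    refine Finset.sum_congr rfl fun x _ => ?_
    congr 1
    simp [apply_ite]
  have h2 : ∀ i, ∑ s : Bool, ((if s = true ∧ y i = true then -1 else 1) *
      (if s = true ∧ z i = true then -1 else 1) : ℂ) = if y i = z i then 2 else 0 := by
    intro i
    cases y i <;> cases z i <;> norm_num
  have h3 := Fintype.prod_sum (fun (i : Fin m) (s : Bool) =>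
    ((if s = true ∧ y i = true then -1 else 1) * (if s = true ∧ z i = true then -1 else 1) : ℂ))
  rw [h1, ← h3]
  simp only [h2]
  by_cases hyz : y = z
  · subst hyz
    simp
  · obtain ⟨i, hi⟩ := Function.ne_iff.1 hyz
    rw [Finset.prod_eq_zero (Finset.mem_univ i) (by simp [hi])]
    simp [hyz]

theorem norm_hadamard_le (m : ℕ) : ‖hadamard m‖ ≤ √(2 ^ m) := by
  refine Real.le_sqrt_of_sq_le ?_
  rw [sq, ← Matrix.l2_opNorm_conjTranspose_mul_self, hadamard_conjTranspose_mul_self, norm_smul]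
  simp

open Classical in
theorem hadamard_eq (m : ℕ) (x y : Fin m → Bool) :
    hadamard m x y = if IP m x y then -1 else 1 := by
  rw [hadamard, Finset.prod_ite, Finset.prod_const, Finset.prod_const_one, mul_one, IP]
  split_ifs with h
  · exact Odd.neg_one_pow (by convert h)
  · exact Even.neg_one_pow (Nat.not_odd_iff_even.1 (by convert h))

theorem hadamard_sum_le (m : ℕ) :
    ‖∑ x, ∑ y, hadamard m x y‖ ≤ √(2 ^ m) * 2 ^ m := by
  -- The constant kernel `1` is the inner product of one-dimensional unit vectors.
  have := norm_sum_mul_inner_le (hadamard m) (fun _ (_ : Unit) => 1) (fun _ _ => 1) (C := 1)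
    (by simp) (by simp)
  simp only [Finset.univ_unique, Finset.sum_const, star_one, mul_one, Finset.card_singleton,
    one_smul, Fintype.card_fun, Fintype.card_bool, Fintype.card_fin] at this
  rw [Real.mul_self_sqrt (by positivity)] at this
  push_cast at this
  exact this.trans (mul_le_mul_of_nonneg_right (norm_hadamard_le m) (by positivity))

/-- A protocol for the inner product function, with any prior entanglement, communicates at least
`(m - 7) / 4` qubits. -/
theorem Protocol.le_cost_of_computes_IP {m a b : ℕ}
    (P : Protocol (Fin m → Bool) (Fin m → Bool) a b) (ψ : JointState a b) (hψ : ψ.IsUnit)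
    (hP : P.Computes ψ allInputs (IP m)) : m ≤ 4 * P.cost + 7 := by
  classical
  have h1 := P.norm_sum_mul_acceptProb_le ψ hψ (hadamard m)
  simp only [Fintype.card_fun, Fintype.card_bool, Fintype.card_fin, ← sq] at h1
  rw [Real.sq_sqrt (by positivity)] at h1
  push_cast at h1
  have h2 := hadamard_sum_le m
  -- Correctness makes `1 - 2p` agree in sign with the Hadamard entry and have absolute value at
  -- least `1/3`, at each of the `4 ^ m` input pairs.
  have h4 : (2 : ℝ) ^ m * 2 ^ m * (1 / 3) ≤
      ‖∑ x, ∑ y, hadamard m x y * (1 - 2 * (P.acceptProb x y ψ : ℂ))‖ := by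
    refine le_trans ?_ (Complex.re_le_norm _)
    rw [Complex.re_sum]
    have : (2 : ℝ) ^ m * 2 ^ m * (1 / 3) =
        ∑ x : Fin m → Bool, ∑ y : Fin m → Bool, (1 / 3 : ℝ) := by
      simp [mul_assoc]
    rw [this]
    refine Finset.sum_le_sum fun x _ => ?_
    rw [Complex.re_sum]
    refine Finset.sum_le_sum fun y _ => ?_
    obtain ⟨hy, hn⟩ := hP x y trivial
    have e : (hadamard m x y * (1 - 2 * (P.acceptProb x y ψ : ℂ))).re =
        if IP m x y then 2 * P.acceptProb x y ψ - 1 else 1 - 2 * P.acceptProb x y ψ := by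
      rw [hadamard_eq]
      split_ifs <;> simp
    rw [e]
    split_ifs with h
    · linarith [hy h]
    · linarith [hn h]
  have h5 : ‖∑ x, ∑ y, hadamard m x y * (1 - 2 * (P.acceptProb x y ψ : ℂ))‖ ≤
      √(2 ^ m) * 2 ^ m + 2 * (4 ^ P.cost * (√(2 ^ m) * 2 ^ m)) := by
    have e : ∑ x, ∑ y, hadamard m x y * (1 - 2 * (P.acceptProb x y ψ : ℂ)) =
        ∑ x, ∑ y, hadamard m x y -
          2 * ∑ x, ∑ y, hadamard m x y * (P.acceptProb x y ψ : ℂ) := by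
      simp only [Finset.mul_sum, ← Finset.sum_sub_distrib]
      exact Finset.sum_congr rfl fun x _ => Finset.sum_congr rfl fun y _ => by ring
    rw [e]
    refine (norm_sub_le _ _).trans (add_le_add h2 ?_)
    rw [norm_mul, Complex.norm_two]
    refine mul_le_mul_of_nonneg_left (h1.trans ?_) zero_le_two
    gcongr
    exact norm_hadamard_le m
  have hs : √((2 : ℝ) ^ m) * √(2 ^ m) = 2 ^ m := Real.mul_self_sqrt (by positivity)
  have hs0 : 0 < √((2 : ℝ) ^ m) := by positivity
  have h40 : (1 : ℝ) ≤ 4 ^ P.cost := one_le_pow₀ (by norm_num)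
  -- `9 = 3 * (1 + 2)`: the error `1/3` gives the `3`, and `1 + 2 * 4 ^ q ≤ 3 * 4 ^ q`.
  have h6 : (2 : ℝ) ^ m * (√(2 ^ m) * √(2 ^ m)) ≤ 2 ^ m * (√(2 ^ m) * (9 * 4 ^ P.cost)) := by
    have : √((2 : ℝ) ^ m) * 2 ^ m ≤ √(2 ^ m) * 2 ^ m * 4 ^ P.cost :=
      le_mul_of_one_le_right (by positivity) h40
    rw [hs]
    linarith
  have h7 : √((2 : ℝ) ^ m) ≤ 9 * 4 ^ P.cost :=
    le_of_mul_le_mul_left (le_of_mul_le_mul_left h6 (by positivity)) hs0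
  -- Squaring turns `9` into `81 ≤ 2 ^ 7`.
  have h8 : (2 : ℝ) ^ m ≤ 2 ^ (4 * P.cost + 7) := by
    calc (2 : ℝ) ^ m = √(2 ^ m) * √(2 ^ m) := hs.symm
      _ ≤ (9 * 4 ^ P.cost) * (9 * 4 ^ P.cost) := mul_self_le_mul_self hs0.le h7
      _ = 81 * 2 ^ (4 * P.cost) := by
        rw [show (4 : ℝ) = 2 ^ 2 by norm_num, ← pow_mul, show 4 * P.cost = 2 * P.cost + 2 * P.cost
          by ring, pow_add]
        ring
      _ ≤ _ := by
        rw [pow_add, mul_comm]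
        exact mul_le_mul_of_nonneg_left (by norm_num) (by positivity)
  exact (pow_le_pow_iff_right₀ one_lt_two).1 h8


/-! ### Perfect matchings as permutations -/

theorem bipartiteGraph_adj_inl {n : ℕ} {E : Set (Fin n × Fin n)} {i : Fin n} {v : Fin n ⊕ Fin n} :
    (bipartiteGraph E).Adj (Sum.inl i) v ↔ ∃ j, (i, j) ∈ E ∧ v = Sum.inr j := by
  simp only [bipartiteGraph, SimpleGraph.fromRel_adj]
  constructor
  · rintro ⟨-, ⟨e, he, h1, h2⟩ | ⟨e, he, h1, h2⟩⟩
    · obtain rfl := Sum.inl_injective h1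
      exact ⟨e.2, he, h2⟩
    · cases h2
  · rintro ⟨j, hj, rfl⟩
    exact ⟨by simp, Or.inl ⟨(i, j), hj, rfl, rfl⟩⟩

theorem bipartiteGraph_adj_inr {n : ℕ} {E : Set (Fin n × Fin n)} {j : Fin n} {v : Fin n ⊕ Fin n} :
    (bipartiteGraph E).Adj (Sum.inr j) v ↔ ∃ i, (i, j) ∈ E ∧ v = Sum.inl i := by
  simp only [bipartiteGraph, SimpleGraph.fromRel_adj]
  constructor
  · rintro ⟨-, ⟨e, he, h1, h2⟩ | ⟨e, he, h1, h2⟩⟩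
    · cases h1
    · obtain rfl := Sum.inr_injective h2
      exact ⟨e.1, he, h1⟩
  · rintro ⟨i, hi, rfl⟩
    exact ⟨by simp, Or.inr ⟨(i, j), hi, rfl, rfl⟩⟩

theorem matching_iff_exists_perm {n : ℕ} {EA EB : Set (Fin n × Fin n)} :
    Matching n EA EB ↔ ∃ σ : Equiv.Perm (Fin n), ∀ i, (i, σ i) ∈ EA ∪ EB := by
  constructor
  · rintro ⟨M, hM⟩
    have h : ∀ i, ∃ j, (i, j) ∈ EA ∪ EB ∧ M.Adj (Sum.inl i) (Sum.inr j) := by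
      intro i
      obtain ⟨w, hw, -⟩ := SimpleGraph.Subgraph.isPerfectMatching_iff.1 hM (Sum.inl i)
      obtain ⟨j, hj, rfl⟩ := bipartiteGraph_adj_inl.1 (M.adj_sub hw)
      exact ⟨j, hj, hw⟩
    choose f hf hM' using h
    have hinj : Function.Injective f := fun i i' hii' =>
      Sum.inl_injective (hM.1.eq_of_adj_right (hM' i) (hii' ▸ hM' i'))
    exact ⟨Equiv.ofBijective f (Finite.injective_iff_bijective.1 hinj), hf⟩
  · rintro ⟨σ, hσ⟩
    refine ⟨{ verts := Set.univ
              Adj := fun u v => (∃ i, u = Sum.inl i ∧ v = Sum.inr (σ i)) ∨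
                ∃ i, v = Sum.inl i ∧ u = Sum.inr (σ i)
              adj_sub := ?_
              edge_vert := fun _ => Set.mem_univ _
              symm := ⟨fun _ _ => Or.symm⟩ }, ?_⟩
    · rintro u v (⟨i, rfl, rfl⟩ | ⟨i, rfl, rfl⟩)
      · exact bipartiteGraph_adj_inl.2 ⟨_, hσ i, rfl⟩
      · exact bipartiteGraph_adj_inr.2 ⟨_, hσ i, rfl⟩
    · rw [SimpleGraph.Subgraph.isPerfectMatching_iff]
      rintro (i | j)
      · exact ⟨Sum.inr (σ i), by simp, by simp⟩
      · exact ⟨Sum.inl (σ.symm j), by simp, by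
          simpa using fun i (h : j = σ i) => by simp [h]⟩

/-- Edge sets on any type with `n` elements can be moved to `Fin n`. -/
theorem matching_preimage_iff {V : Type*} {n : ℕ} (e : Fin n ≃ V) (EA EB : Set (V × V)) :
    Matching n (Prod.map e e ⁻¹' EA) (Prod.map e e ⁻¹' EB) ↔
      ∃ σ : Equiv.Perm V, ∀ v, (v, σ v) ∈ EA ∪ EB := by
  rw [matching_iff_exists_perm, ← (e.permCongr).exists_congr_right]
  refine exists_congr fun σ => ?_
  rw [← e.forall_congr_right]
  simp

/-! ### The parity graph and the reduction -/

/-- The vertices of the parity graph: a state of the program before bit `i` is read is a pair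
`(i, b)` in the first summand, an intermediate state, entered when `x i = 1`, is a pair `(i, b)`
in the second summand, and `r` further vertices serve as padding. -/
abbrev ParityVertex (m r : ℕ) : Type := (Fin (m + 1) × Bool) ⊕ (Fin m × Bool) ⊕ Fin r

/-- The state with parity `b` before bit `i` is read. -/
abbrev ParityVertex.state {m : ℕ} (r : ℕ) (i : Fin (m + 1)) (b : Bool) : ParityVertex m r :=
  Sum.inl (i, b)

/-- The intermediate state with parity `b` after `x i = 1` has been read. -/
abbrev ParityVertex.mid {m : ℕ} (r : ℕ) (i : Fin m) (b : Bool) : ParityVertex m r :=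
  Sum.inr (Sum.inl (i, b))

open ParityVertex

/-- The edges of Alice. -/
inductive AliceEdge {m : ℕ} (r : ℕ) (x : Fin m → Bool) : ParityVertex m r → ParityVertex m r → Prop
  | loop (v) : v ≠ state r 0 false → v ≠ state r (Fin.last m) true → AliceEdge r x v v
  | close : AliceEdge r x (state r (Fin.last m) true) (state r 0 false)
  | stay (i b) : x i = false → AliceEdge r x (state r i.castSucc b) (state r i.succ b)
  | enter (i b) : x i = true → AliceEdge r x (state r i.castSucc b) (mid r i b)

/-- The edges of Bob. -/
inductive BobEdge {m : ℕ} (r : ℕ) (y : Fin m → Bool) : ParityVertex m r → ParityVertex m r → Prop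
  | leave (i b) : BobEdge r y (mid r i b) (state r i.succ (xor b (y i)))

theorem not_aliceEdge_of_bobEdge {m r : ℕ} {x y : Fin m → Bool} {v w : ParityVertex m r}
    (hB : BobEdge r y v w) : ¬ AliceEdge r x v w := by
  intro hA
  cases hB
  cases hA

theorem not_aliceEdge_zero {m r : ℕ} {x : Fin m → Bool} :
    ¬ AliceEdge r x (state r 0 false) (state r 0 false) := by
  suffices ∀ v w, AliceEdge r x v w → v = state r 0 false → w ≠ state r 0 false from
    fun h => this _ _ h rfl rfl
  intro v w h hv hw
  cases h with
  | loop _ h1 => exact h1 hv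
  | close => simp at hv
  | stay => simp at hw
  | enter => simp at hw

/-- The parity of the inner product of the bits before position `i`. -/
def prefixParity {m : ℕ} (x y : Fin m → Bool) (i : Fin (m + 1)) : Bool :=
  decide (Odd (Finset.univ.filter fun j : Fin m => j.castSucc < i ∧ x j = true ∧ y j = true).card)

theorem prefixParity_zero {m : ℕ} (x y : Fin m → Bool) : prefixParity x y 0 = false := by
  simp [prefixParity]

theorem prefixParity_last {m : ℕ} (x y : Fin m → Bool) :
    prefixParity x y (Fin.last m) = true ↔ IP m x y := by
  simp [prefixParity, IP, Fin.castSucc_lt_last]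

theorem prefixParity_succ {m : ℕ} (x y : Fin m → Bool) (i : Fin m) :
    prefixParity x y i.succ = xor (prefixParity x y i.castSucc) (x i && y i) := by
  simp only [prefixParity, Fin.castSucc_lt_succ_iff, Fin.castSucc_lt_castSucc_iff]
  by_cases h : x i = true ∧ y i = true
  · have : (Finset.univ.filter fun j : Fin m => j ≤ i ∧ x j = true ∧ y j = true) =
        insert i (Finset.univ.filter fun j : Fin m => j < i ∧ x j = true ∧ y j = true) := by
      ext j
      simp only [Finset.mem_filter, Finset.mem_univ, true_and, Finset.mem_insert, le_iff_eq_or_lt]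
      constructor
      · rintro ⟨h1 | h1, h2⟩
        exacts [Or.inl h1, Or.inr ⟨h1, h2⟩]
      · rintro (rfl | ⟨h1, h2⟩)
        exacts [⟨Or.inl rfl, h⟩, ⟨Or.inr h1, h2⟩]
    rw [this, Finset.card_insert_of_notMem (by simp)]
    simp [h.1, h.2, Nat.odd_add_one, -Nat.not_odd_iff_even]
  · have : (Finset.univ.filter fun j : Fin m => j ≤ i ∧ x j = true ∧ y j = true) =
        Finset.univ.filter fun j : Fin m => j < i ∧ x j = true ∧ y j = true := by
      ext j
      simp only [Finset.mem_filter, Finset.mem_univ, true_and, le_iff_eq_or_lt]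
      constructor
      · rintro ⟨rfl | h1, h2⟩
        exacts [absurd h2 h, ⟨h1, h2⟩]
      · rintro ⟨h1, h2⟩
        exact ⟨Or.inr h1, h2⟩
    rw [this]
    have h' : (x i && y i) = false := by
      cases hx : x i <;> cases hy : y i <;> simp_all
    simp [h']

section Perm

variable {m r : ℕ} {x y : Fin m → Bool}

/-- If `σ` moves `v`, injectivity forces it to move `σ v` too. The start has no loop, so it is
moved; before the last layer each path vertex has a unique non-loop edge, leading to the next path
vertex, so the movement propagates along the path. -/
theorem perm_state_ne_self {σ : Equiv.Perm (ParityVertex m r)}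
    (hσ : ∀ v, AliceEdge r x v (σ v) ∨ BobEdge r y v (σ v)) (i : Fin (m + 1)) :
    σ (state r i (prefixParity x y i)) ≠ state r i (prefixParity x y i) := by
  have step : ∀ {v w}, σ v ≠ v → σ v = w → σ w ≠ w := fun hv hw h =>
    hv (σ.injective ((congrArg σ hw).trans (h.trans hw.symm)))
  induction i using Fin.induction with
  | zero =>
    rw [prefixParity_zero]
    intro h
    have := hσ (state r 0 false)
    rw [h] at this
    rcases this with h | h
    · exact not_aliceEdge_zero h
    · cases h
  | succ i ih =>
    generalize hv : state r i.castSucc (prefixParity x y i.castSucc) = v at ih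
    generalize hw : σ v = w at ih
    have h := hσ v
    rw [hw] at h
    rcases h with h | h
    · cases h with
      | loop => exact absurd rfl ih
      | close => simp at hv
      | stay j b hj =>
        simp only [Sum.inl.injEq, Prod.mk.injEq, Fin.castSucc_inj] at hv
        obtain ⟨rfl, rfl⟩ := hv
        refine step (by rw [hw]; exact ih) (hw.trans ?_)
        rw [prefixParity_succ, hj]
        simp
      | enter j b hj =>
        simp only [Sum.inl.injEq, Prod.mk.injEq, Fin.castSucc_inj] at hv
        obtain ⟨rfl, rfl⟩ := hv
        have h2 : σ (mid r i (prefixParity x y i.castSucc)) ≠ _ :=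
          step (by rw [hw]; exact ih) hw
        refine step h2 ?_
        generalize hv' : mid r i (prefixParity x y i.castSucc) = v' at h2
        generalize hw' : σ v' = w' at h2
        have h := hσ v'
        rw [hw'] at h
        rcases h with h | h
        · cases h with
          | loop => exact absurd rfl h2
          | close => cases hv'
          | stay => cases hv'
          | enter => cases hv'
        · cases h with
          | leave k c =>
            simp only [Sum.inr.injEq, Sum.inl.injEq, Prod.mk.injEq] at hv'
            obtain ⟨rfl, rfl⟩ := hv'
            rw [prefixParity_succ, hj, Bool.true_and]
    · cases h
      cases hv

/-- The path vertex in the last layer is moved, and the only non-loop edge out of that layer starts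
at parity `true`. -/
theorem prefixParity_last_of_perm {σ : Equiv.Perm (ParityVertex m r)}
    (hσ : ∀ v, AliceEdge r x v (σ v) ∨ BobEdge r y v (σ v)) :
    prefixParity x y (Fin.last m) = true := by
  have h := perm_state_ne_self hσ (Fin.last m)
  generalize hv : state r (Fin.last m) (prefixParity x y (Fin.last m)) = v at h
  generalize hw : σ v = w at h
  have h' := hσ v
  rw [hw] at h'
  rcases h' with h' | h'
  · cases h' with
    | loop => exact absurd rfl h
    | close => simpa using hv
    | stay j =>
      simp only [Sum.inl.injEq, Prod.mk.injEq] at hv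
      exact absurd hv.1.symm (Fin.castSucc_lt_last j).ne
    | enter j =>
      simp only [Sum.inl.injEq, Prod.mk.injEq] at hv
      exact absurd hv.1.symm (Fin.castSucc_lt_last j).ne
  · cases h'
    cases hv

variable (r x y) in
/-- The map that moves the vertices on the computation path along it, closes the path up to a
cycle, and fixes the other vertices. -/
def parityMap : ParityVertex m r → ParityVertex m r
  | Sum.inl (i, b) =>
      if b = prefixParity x y i then
        Fin.lastCases (state r 0 false)
          (fun j => if x j = true then mid r j b else state r j.succ b) i
      else state r i b
  | Sum.inr (Sum.inl (j, b)) =>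
      if x j = true ∧ b = prefixParity x y j.castSucc then state r j.succ (xor b (y j))
      else mid r j b
  | Sum.inr (Sum.inr k) => Sum.inr (Sum.inr k)

theorem parityMap_edge (h : prefixParity x y (Fin.last m) = true) (v : ParityVertex m r) :
    AliceEdge r x v (parityMap r x y v) ∨ BobEdge r y v (parityMap r x y v) := by
  rcases v with ⟨i, b⟩ | ⟨j, b⟩ | k
  · by_cases hb : b = prefixParity x y i
    · simp only [parityMap, if_pos hb]
      induction i using Fin.lastCases with
      | last =>
        rw [h] at hb
        subst hb
        rw [Fin.lastCases_last]
        exact Or.inl .close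
      | cast j =>
        rw [Fin.lastCases_castSucc]
        split_ifs with hx
        · exact Or.inl (.enter j b hx)
        · exact Or.inl (.stay j b (by simpa using hx))
    · simp only [parityMap, if_neg hb]
      refine Or.inl (.loop _ ?_ ?_)
      · intro h1
        simp only [Sum.inl.injEq, Prod.mk.injEq] at h1
        rw [h1.1, h1.2, prefixParity_zero] at hb
        exact hb rfl
      · intro h1
        simp only [Sum.inl.injEq, Prod.mk.injEq] at h1
        rw [h1.1, h1.2, h] at hb
        exact hb rfl
  · by_cases hb : x j = true ∧ b = prefixParity x y j.castSucc
    · simp only [parityMap, if_pos hb]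
      exact Or.inr (.leave j b)
    · simp only [parityMap, if_neg hb]
      exact Or.inl (.loop _ (by simp) (by simp))
  · exact Or.inl (.loop _ (by simp) (by simp))

/-- A vertex on the path is hit by its predecessor, cyclically, and any other vertex by itself;
finiteness then gives bijectivity. -/
theorem parityMap_surjective (h : prefixParity x y (Fin.last m) = true) :
    Function.Surjective (parityMap r x y) := by
  rintro (⟨i, b⟩ | ⟨j, b⟩ | k)
  · by_cases hb : b = prefixParity x y i
    · subst hb
      induction i using Fin.cases with
      | zero =>
        refine ⟨state r (Fin.last m) true, ?_⟩
        simp [parityMap, h, prefixParity_zero]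
      | succ j =>
        cases hx : x j with
        | false =>
          refine ⟨state r j.castSucc (prefixParity x y j.castSucc), ?_⟩
          simp [parityMap, hx, prefixParity_succ]
        | true =>
          refine ⟨mid r j (prefixParity x y j.castSucc), ?_⟩
          simp [parityMap, hx, prefixParity_succ]
    · exact ⟨state r i b, by simp [parityMap, hb]⟩
  · by_cases hb : x j = true ∧ b = prefixParity x y j.castSucc
    · exact ⟨state r j.castSucc b, by simp [parityMap, hb.1, hb.2]⟩
    · exact ⟨mid r j b, by simp only [parityMap, if_neg hb]⟩
  · exact ⟨Sum.inr (Sum.inr k), rfl⟩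

theorem exists_perm_iff_IP :
    (∃ σ : Equiv.Perm (ParityVertex m r),
      ∀ v, AliceEdge r x v (σ v) ∨ BobEdge r y v (σ v)) ↔ IP m x y := by
  rw [← prefixParity_last]
  constructor
  · rintro ⟨σ, hσ⟩
    exact prefixParity_last_of_perm hσ
  · intro h
    exact ⟨Equiv.ofBijective _ (Finite.surjective_iff_bijective.1 (parityMap_surjective h)),
      parityMap_edge h⟩

end Perm

/-- The inner product problem on `m` bits reduces to `Matching n` whenever `4 * m + 2 ≤ n`. -/
theorem exists_reduction {m n : ℕ} (h : 4 * m + 2 ≤ n) :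
    ∃ α β : (Fin m → Bool) → Set (Fin n × Fin n), ∀ x y : Fin m → Bool,
      Disjoint (α x) (β y) ∧ (Matching n (α x) (β y) ↔ IP m x y) := by
  -- The graph has `2 * (m + 1) + 2 * m = 4 * m + 2` proper vertices; the `r` padding vertices carry
  -- only loops.
  obtain ⟨r, rfl⟩ := Nat.exists_eq_add_of_le h
  have e : Fin (4 * m + 2 + r) ≃ ParityVertex m r :=
    (Fintype.equivFinOfCardEq (by simp; ring)).symm
  refine ⟨fun x => Prod.map e e ⁻¹' {p | AliceEdge r x p.1 p.2},
    fun y => Prod.map e e ⁻¹' {p | BobEdge r y p.1 p.2}, fun x y => ⟨?_, ?_⟩⟩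
  · exact Disjoint.preimage _
      (Set.disjoint_left.2 fun p hA hB => not_aliceEdge_of_bobEdge hB hA)
  · rw [matching_preimage_iff]
    exact exists_perm_iff_IP

/-! ### Transfer of lower bounds along reductions -/

section Comap

variable {X Y X' Y' : Type*}

/-- Precomposition of a protocol with maps of the inputs. -/
def Protocol.comap (α : X' → X) (β : Y' → Y) : {a b : ℕ} → Protocol X Y a b → Protocol X' Y' a b
  | _, _, .aliceSend U rest => .aliceSend (U ∘ α) (rest.comap α β)
  | _, _, .bobSend V rest => .bobSend (V ∘ β) (rest.comap α β)
  | _, _, .aliceOutput U => .aliceOutput (U ∘ α)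
  | _, _, .bobOutput V => .bobOutput (V ∘ β)

theorem Protocol.cost_comap (α : X' → X) (β : Y' → Y) {a b : ℕ} (P : Protocol X Y a b) :
    (P.comap α β).cost = P.cost := by
  induction P with
  | aliceSend U rest ih => simp [Protocol.comap, Protocol.cost, ih]
  | bobSend V rest ih => simp [Protocol.comap, Protocol.cost, ih]
  | aliceOutput U => rfl
  | bobOutput V => rfl

theorem Protocol.acceptProb_comap (α : X' → X) (β : Y' → Y) {a b : ℕ} (P : Protocol X Y a b)
    (x : X') (y : Y') (ψ : JointState a b) :
    (P.comap α β).acceptProb x y ψ = P.acceptProb (α x) (β y) ψ := by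
  induction P with
  | aliceSend U rest ih => simp [Protocol.comap, Protocol.acceptProb, ih]
  | bobSend V rest ih => simp [Protocol.comap, Protocol.acceptProb, ih]
  | aliceOutput U => rfl
  | bobOutput V => rfl

theorem Q₂Ent_le_of_imp {D D' f : X → Y → Prop} (h : ∀ x y, D x y → D' x y) :
    Q₂Ent D f ≤ Q₂Ent D' f :=
  le_iInf fun a => le_iInf fun b => le_iInf fun ψ => le_iInf fun hψ => le_iInf fun P =>
    le_iInf fun hP => iInf_le_of_le a <| iInf_le_of_le b <| iInf_le_of_le ψ <|
      iInf_le_of_le hψ <| iInf_le_of_le P <| iInf_le _ fun x y hD => hP x y (h x y hD)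

theorem Q₂Ent_le_Q₂ (D f : X → Y → Prop) : Q₂Ent D f ≤ Q₂ D f :=
  le_iInf fun P => le_iInf fun hP => iInf_le_of_le 0 <| iInf_le_of_le 0 <|
    iInf_le_of_le JointState.empty <|
      iInf_le_of_le (by simp [JointState.IsUnit, JointState.empty]) <|
        iInf_le_of_le P <| iInf_le _ hP

end Comap

theorem le_Q₂Ent_matching {n : ℕ} (hn : 98 ≤ n) :
    ((n / 32 + 1 : ℕ) : ℕ∞) ≤ Q₂Ent (disjointEdges n) (Matching n) := by
  refine le_iInf fun a => le_iInf fun b => le_iInf fun ψ => le_iInf fun hψ => le_iInf fun P =>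
    le_iInf fun hP => ?_
  -- This `m` is at least `(n - 5) / 4`, so the cost is at least `(n - 33) / 16`, which reaches `n /
  -- 32 + 1` exactly when `n ≥ 98`. The `+ 1` absorbs the rounding of `n / 32`.
  obtain ⟨α, β, h⟩ := exists_reduction (m := (n - 2) / 4) (n := n) (by omega)
  have hc := (P.comap α β).le_cost_of_computes_IP ψ hψ fun x y _ => by
    rw [Protocol.acceptProb_comap, ← (h x y).2]
    exact hP _ _ (h x y).1
  rw [Protocol.cost_comap] at hc
  exact Nat.cast_le.2 (by omega)

theorem ofReal_le_Q₂Ent_matching {n : ℕ} (hn : 98 ≤ n) :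
    ENNReal.ofReal (1 / 32 * n) ≤ (Q₂Ent (disjointEdges n) (Matching n) : ENNReal) := by
  have h1 : ((n / 32 + 1 : ℕ) : ENNReal) ≤ (Q₂Ent (disjointEdges n) (Matching n) : ENNReal) := by
    exact_mod_cast ENat.toENNReal_mono (le_Q₂Ent_matching hn)
  refine le_trans ?_ h1
  rw [← ENNReal.ofReal_natCast]
  refine ENNReal.ofReal_le_ofReal ?_
  have h2 : (n : ℝ) ≤ ((32 * (n / 32 + 1) : ℕ) : ℝ) := Nat.cast_le.2 (by omega)
  push_cast at h2 ⊢
  linarith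

end QComm

theorem mainTheorem2 :
    (∃ c : ℝ, 0 < c ∧ ∀ᶠ n : ℕ in Filter.atTop,
      ENNReal.ofReal (c * n) ≤ (QComm.Q₂ QComm.allInputs (QComm.Matching n) : ENNReal) ∧
      ENNReal.ofReal (c * n) ≤ (QComm.Q₂Ent QComm.allInputs (QComm.Matching n) : ENNReal) ∧
      ENNReal.ofReal (c * n) ≤
        (QComm.Q₂Ent (QComm.disjointEdges n) (QComm.Matching n) : ENNReal)) ∧
    (∃ k : ℕ, ∀ m : ℕ, 1 ≤ m → ∃ n : ℕ, n ≤ k * m ∧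
      ∃ (α β : (Fin m → Bool) → Set (Fin n × Fin n)), ∀ x y : Fin m → Bool,
        Disjoint (α x) (β y) ∧ (QComm.Matching n (α x) (β y) ↔ QComm.IP m x y)) := by
  -- `4 * m + 2 ≤ 6 * m` because `m ≥ 1`.
  refine ⟨⟨1 / 32, by norm_num, ?_⟩, 6, fun m hm => ⟨4 * m + 2, by omega,
    QComm.exists_reduction le_rfl⟩⟩
  filter_upwards [Filter.eventually_ge_atTop 98] with n hn
  have h1 := QComm.ofReal_le_Q₂Ent_matching hn
  have h2 := h1.trans (ENat.toENNReal_mono (QComm.Q₂Ent_le_of_imp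
    (D' := QComm.allInputs) fun _ _ _ => trivial))
  exact ⟨h2.trans (ENat.toENNReal_mono (QComm.Q₂Ent_le_Q₂ _ _)), h2, h1⟩
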